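/- All graphs are finite and simple. For a graph $G$ with at least one vertex let $m(G)=\max_{J\subseteq G,\ v(J)\ge 1} e(J)/v(J)$. For a graph $H$ on at least three vertices let $d_2(H)=\frac{e(H)-1}{v(H)-2}$ and $m_2(H)=\max_{J\subseteq H,\ v(J)\ge 3} d_2(J)$; $H$ is called strictly 2-balanced if $m_2(H)=d_2(H)$ and $d_2(J)<m_2(H)$ for every proper subgraph $J\subsetneq H$ with at least three vertices. In the (Maker–Breaker) $H$-game on $E(G)$, Maker and Breaker alternately claim unclaimed edges of $G$, one edge per move, with Maker moving first, until all edges are claimed; Maker wins if he has claimed all the edges of some (not necessarily induced) copy of $H$ in $G$, and Breaker wins otherwise. **Theorem 4.3.** Let $G$ and $H$ be graphs such that $m(G)\le m_2(H)$ and $H$ is strictly 2-balanced with at least $4$ vertices, where $H$ is not the disjoint union of two edges, $2K_2$. Then Breaker has a winning strategy in the $H$-game on $E(G)$. -/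

import Mathlib

/-! ### Maker-Breaker games on a finite board -/

namespace MakerBreaker

/-- A strategy on the board `X`: given the list `h` of all moves made so far (in chronological
order), on which some element is still unclaimed, it names an unclaimed element to be claimed. -/
structure Strategy (X : Type*) where
  /-- the element claimed after the moves `h` -/
  move : (h : List X) → (∃ x, x ∉ h) → X
  /-- only unclaimed elements are claimed -/
  legal : ∀ (h : List X) (free : ∃ x, x ∉ h), move h free ∉ h

variable {X : Type*}

/-- A complete play: the chronological list of all moves of both players. No element is claimed
twice, and the play ends when all elements are claimed. Maker makes the moves at the indices
`0, 2, 4, …` (so Maker starts) and Breaker those at the indices `1, 3, 5, …`. -/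
def IsCompletePlay (p : List X) : Prop :=
  p.Nodup ∧ ∀ x, x ∈ p

/-- All of Breaker's moves in the play `p` are made according to the strategy `σ`. -/
def BreakerFollows (σ : Strategy X) (p : List X) : Prop :=
  ∀ (i : ℕ) (hi : i < p.length), Odd i →
    ∃ free : (∃ x, x ∉ p.take i), p[i] = σ.move (p.take i) free

/-- The set of elements claimed by Maker in the play `p`. -/
def makerSet (p : List X) : Set X :=
  {x | ∃ (i : ℕ) (hi : i < p.length), Even i ∧ p[i] = x}

/-- Breaker has a winning strategy in the Maker-Breaker game on the finite board `X` with family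
of winning sets `E`, where Maker starts: however Maker plays, at the end of the game Maker has not
claimed all elements of a winning set. -/
def BreakerHasWinningStrategy [Finite X] (E : Set (Set X)) : Prop :=
  ∃ σ : Strategy X, ∀ p : List X, IsCompletePlay p → BreakerFollows σ p →
    ∀ A ∈ E, ¬ A ⊆ makerSet p

end MakerBreaker

/-! ### The `H`-game and densities of graphs -/

namespace SimpleGraph

variable {V W : Type*}

/-- The winning sets of the `H`-game on the edge set of `G`: the edge sets of all (not necessarily
induced) copies of `H` in `G`. -/
def copyEdgeSets (H : SimpleGraph W) (G : SimpleGraph V) : Set (Set G.edgeSet) :=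
  {A | ∃ f : Copy H G, A = Set.range f.mapEdgeSet}

/-- The density `e(G) / v(G)`. -/
noncomputable def density (G : SimpleGraph V) : ℝ :=
  (G.edgeSet.ncard : ℝ) / (Nat.card V : ℝ)

/-- The maximum density `m(G)`: the maximum of `e(J) / v(J)` over all subgraphs `J` of the finite
graph `G` with at least one vertex. -/
noncomputable def maxDensity [Finite V] (G : SimpleGraph V) : ℝ :=
  sSup {d | ∃ J : G.Subgraph, J.verts.Nonempty ∧ d = J.coe.density}

/-- `d₂(G) = (e(G) - 1) / (v(G) - 2)`, used for graphs on at least three vertices. -/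
noncomputable def twoDensity (G : SimpleGraph V) : ℝ :=
  ((G.edgeSet.ncard : ℝ) - 1) / ((Nat.card V : ℝ) - 2)

/-- The 2-density `m₂(G)`: the maximum of `d₂(J)` over all subgraphs `J` of the finite graph `G`
with at least three vertices. -/
noncomputable def maxTwoDensity [Finite V] (G : SimpleGraph V) : ℝ :=
  sSup {d | ∃ J : G.Subgraph, 3 ≤ Nat.card J.verts ∧ d = J.coe.twoDensity}

/-- A graph on at least three vertices is strictly 2-balanced if `m₂(G) = d₂(G)`, and
`m₂(G) > d₂(J)` for every proper subgraph `J` of `G` with at least three vertices. -/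
def IsStrictlyTwoBalanced [Finite V] (G : SimpleGraph V) : Prop :=
  3 ≤ Nat.card V ∧ G.maxTwoDensity = G.twoDensity ∧
    ∀ J : G.Subgraph, J ≠ ⊤ → 3 ≤ Nat.card J.verts → J.coe.twoDensity < G.maxTwoDensity

end SimpleGraph

/-! Weigh Maker's edges 2, free edges 1, Breaker's edges 0, and give each set `A i` a capacity `2 *
b i`. Breaker keeps every weight within capacity, so Maker never owns more than `b i` elements of `A
i`. A Maker move `e` only endangers the tight sets through `e`. Submodularity makes these closed
under intersection, so they contain a smallest one; by parity it holds another free element, and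
claiming that repairs every tight set at once. For the `H`-game, the sets are the edges spanned by a
vertex set `S`, and `b` is affine in `|S|` with value `e(H) - 1` at `|S| = v(H)`. An integer slope
for which the capacities dominate the initial weights exists once `d₂(H) > 1`. Strict balancedness
gives this inequality, `2K₂` being the only exception with `d₂(H) ≥ 0`. -/

namespace MakerBreaker

/-! ### Capacities and Breaker's reply -/

section Potential

variable {X ι : Type*} (A : ι → Finset X) (b : ι → ℤ)

/-- The weights `ω` (`2` for Maker's elements, `1` for unclaimed elements, `0` for Breaker's
elements) obey the capacities `2 * b i` on all sets `A i`. -/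
def Capped (ω : X → ℕ) : Prop :=
  ∀ i, ((∑ x ∈ A i, ω x : ℕ) : ℤ) ≤ 2 * b i

variable {A b}

theorem sum_update_of_mem [DecidableEq X] (ω : X → ℕ) {e : X} (S : Finset X) (he : e ∈ S) (c : ℕ) :
    ∑ x ∈ S, Function.update ω e c x + ω e = ∑ x ∈ S, ω x + c := by
  rw [Finset.sum_update_of_mem he, ← Finset.add_sum_erase S ω he, Finset.sdiff_singleton_eq_erase]
  ring

theorem Capped.update_zero [DecidableEq X] {ω : X → ℕ} (h : Capped A b ω) (f : X) :
    Capped A b (Function.update ω f 0) := by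
  intro i
  refine le_trans ?_ (h i)
  norm_cast
  refine Finset.sum_le_sum fun x _ => ?_
  by_cases hx : x = f
  · subst hx; simp
  · simp [hx]

/-- After any move `e` of Maker, the capacities are still obeyed, or Breaker can restore them. -/
theorem Capped.respond [DecidableEq X]
    (hunc : ∀ i j, (A i ∩ A j).Nonempty →
      ∃ p u, A p = A i ∩ A j ∧ A i ∪ A j ⊆ A u ∧ b p + b u ≤ b i + b j)
    {ω : X → ℕ} (h2 : ∀ x, ω x ≤ 2) (h : Capped A b ω) {e : X} (he : ω e = 1) :
    Capped A b (Function.update ω e 2) ∨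
      ∃ f, f ≠ e ∧ ω f = 1 ∧ Capped A b (Function.update (Function.update ω e 2) f 0) := by
  classical
  by_cases htight : ∃ i, e ∈ A i ∧ ((∑ x ∈ A i, ω x : ℕ) : ℤ) = 2 * b i
  · right
    -- Among the tight sets through `e`, take one of least cardinality.
    obtain ⟨n, ⟨t, het, htt, hn⟩, hmin⟩ : ∃ n, (∃ i, e ∈ A i ∧
        ((∑ x ∈ A i, ω x : ℕ) : ℤ) = 2 * b i ∧ (A i).card = n) ∧
        ∀ m < n, ¬ ∃ i, e ∈ A i ∧ ((∑ x ∈ A i, ω x : ℕ) : ℤ) = 2 * b i ∧ (A i).card = m := by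
      obtain ⟨i, hi1, hi2⟩ := htight
      have hex : ∃ n, ∃ i, e ∈ A i ∧ ((∑ x ∈ A i, ω x : ℕ) : ℤ) = 2 * b i ∧ (A i).card = n :=
        ⟨_, i, hi1, hi2, rfl⟩
      exact ⟨Nat.find hex, Nat.find_spec hex, fun m hm => Nat.find_min hex hm⟩
    have hsub : ∀ i, e ∈ A i → ((∑ x ∈ A i, ω x : ℕ) : ℤ) = 2 * b i → A t ⊆ A i := by
      intro i hei hti
      obtain ⟨p, u, hp, hu, hb⟩ := hunc i t ⟨e, by simp [hei, het]⟩
      have h1 : ∑ x ∈ A i ∪ A t, ω x ≤ ∑ x ∈ A u, ω x := Finset.sum_le_sum_of_subset hu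
      have h3 : ∑ x ∈ A i ∪ A t, ω x + ∑ x ∈ A p, ω x = ∑ x ∈ A i, ω x + ∑ x ∈ A t, ω x := by
        rw [hp]; exact Finset.sum_union_inter
      -- Two tight weights sum to at least the weights of `A p` and `A u`, whose capacities total no
      -- more: `A p` has no slack.
      have hpt : ((∑ x ∈ A p, ω x : ℕ) : ℤ) = 2 * b p := by
        have := h p
        have := h u
        omega
      have hcard : n ≤ (A p).card :=
        not_lt.1 fun hlt => hmin _ hlt ⟨p, by simp [hp, hei, het], hpt, rfl⟩
      have hpsub : A p ⊆ A t := by rw [hp]; exact Finset.inter_subset_right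
      have hpe : A p = A t := Finset.eq_of_subset_of_card_le hpsub (by omega)
      rw [← hpe, hp]
      exact Finset.inter_subset_left
    -- Otherwise `e` is the only element of odd weight in `A t`, contradicting the even total `2 * b
    -- t`.
    obtain ⟨f, hft, hfe, hf1⟩ : ∃ f ∈ A t, f ≠ e ∧ ω f = 1 := by
      by_contra! hno
      have hev : Even (∑ x ∈ (A t).erase e, ω x) := by
        refine Finset.even_sum _ fun x hx => ?_
        rw [Finset.mem_erase] at hx
        have := hno x hx.2 hx.1
        have := h2 x
        interval_cases ω x <;> simp_all
      have := Finset.add_sum_erase (A t) ω het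
      obtain ⟨r, hr⟩ := hev
      omega
    refine ⟨f, hfe, hf1, fun i => ?_⟩
    have hi := h i
    by_cases hei : e ∈ A i
    · have h3 := sum_update_of_mem ω (A i) hei 2
      by_cases hti : ((∑ x ∈ A i, ω x : ℕ) : ℤ) = 2 * b i
      · have h4 := sum_update_of_mem (Function.update ω e 2) (A i) (hsub i hei hti hft) 0
        rw [Function.update_of_ne hfe] at h4
        omega
      · by_cases hfi : f ∈ A i
        · have h4 := sum_update_of_mem (Function.update ω e 2) (A i) hfi 0
          omega
        · rw [Finset.sum_update_of_notMem hfi]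
          omega
    · have : Capped A b (Function.update ω f 0) := h.update_zero f
      have h5 := this i
      rw [Function.update_comm hfe.symm, Finset.sum_update_of_notMem hei]
      exact h5
  · left
    intro i
    have hi := h i
    by_cases hei : e ∈ A i
    · have h3 := sum_update_of_mem ω (A i) hei 2
      have h4 : ¬ ((∑ x ∈ A i, ω x : ℕ) : ℤ) = 2 * b i := fun h => htight ⟨i, hei, h⟩
      omega
    · rw [Finset.sum_update_of_notMem hei]
      exact hi

/-! ### Weights along a play and the restoring strategy -/

open Classical in
/-- The weights after the moves `h`, given in chronological order. -/
noncomputable def weight (h : List X) (x : X) : ℕ :=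
  if x ∉ h then 1 else if Even (h.idxOf x) then 2 else 0

theorem weight_le_two (h : List X) (x : X) : weight h x ≤ 2 := by
  unfold weight; split_ifs <;> simp

theorem weight_eq_one_iff {h : List X} {x : X} : weight h x = 1 ↔ x ∉ h := by
  unfold weight; split_ifs <;> simp_all

theorem weight_concat [DecidableEq X] {h : List X} {e : X} (he : e ∉ h) :
    weight (h ++ [e]) = Function.update (weight h) e (if Even h.length then 2 else 0) := by
  classical
  ext x
  by_cases hx : x = e
  · subst hx
    simp [weight, List.idxOf_append, he]
  · by_cases hxh : x ∈ h
    · simp [weight, hx, hxh, List.idxOf_append]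
    · simp [weight, hx, hxh]

theorem weight_eq_two_iff {p : List X} (hp : p.Nodup) {x : X} :
    weight p x = 2 ↔ x ∈ makerSet p := by
  classical
  constructor
  · intro h
    unfold weight at h
    split_ifs at h with h1 h2
    · have h3 := List.idxOf_lt_length_iff.2 h1
      exact ⟨p.idxOf x, h3, h2, List.getElem_idxOf h3⟩
    · omega
  · rintro ⟨i, hi, hev, rfl⟩
    have : p.idxOf p[i] = i := hp.idxOf_getElem i hi
    simp only [weight, List.getElem_mem, not_true_eq_false, if_false]
    rw [if_pos]
    convert hev

open Classical in
/-- Breaker restores the capacities if possible. -/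
noncomputable def restoringStrategy (A : ι → Finset X) (b : ι → ℤ) : Strategy X where
  move h free :=
    if hf : ∃ f, f ∉ h ∧ Capped A b (weight (h ++ [f])) then hf.choose else free.choose
  legal h free := by
    split_ifs with hf
    · exact hf.choose_spec.1
    · exact free.choose_spec

theorem restoringStrategy_capped {h : List X} (free : ∃ x, x ∉ h)
    (hf : ∃ f, f ∉ h ∧ Capped A b (weight (h ++ [f]))) :
    Capped A b (weight (h ++ [(restoringStrategy A b).move h free])) := by
  have : (restoringStrategy A b).move h free = hf.choose := by
    simp only [restoringStrategy]
    rw [dif_pos hf]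
  rw [this]
  exact hf.choose_spec.2

variable [DecidableEq X]

theorem capped_take
    (hunc : ∀ i j, (A i ∩ A j).Nonempty →
      ∃ p u, A p = A i ∩ A j ∧ A i ∪ A j ⊆ A u ∧ b p + b u ≤ b i + b j)
    (hcap : ∀ i, ((A i).card : ℤ) ≤ 2 * b i) {p : List X} (hp : IsCompletePlay p)
    (hσ : BreakerFollows (restoringStrategy A b) p) (j : ℕ) (hj : 2 * j ≤ p.length) :
    Capped A b (weight (p.take (2 * j))) := by
  induction j with
  | zero => intro i; simpa [weight] using hcap i
  | succ j ih =>
    have hlt : 2 * j < p.length := by omega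
    have hlt' : 2 * j + 1 < p.length := by omega
    have hnot : ∀ (i : ℕ) (hi : i < p.length), p[i] ∉ p.take i := by
      intro i hi hmem
      obtain ⟨l, hl, hle⟩ := List.mem_iff_getElem.1 hmem
      simp only [List.length_take] at hl
      rw [List.getElem_take, hp.1.getElem_inj_iff] at hle
      omega
    have e1 : p.take (2 * j + 1) = p.take (2 * j) ++ [p[2 * j]] := by
      rw [List.take_append_getElem]
    have e2 : p.take (2 * (j + 1)) = p.take (2 * j + 1) ++ [p[2 * j + 1]] := by
      rw [List.take_append_getElem]; rfl
    have w1 : weight (p.take (2 * j + 1)) =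
        Function.update (weight (p.take (2 * j))) p[2 * j] 2 := by
      rw [e1, weight_concat (hnot _ hlt), if_pos]
      rw [List.length_take, min_eq_left hlt.le]; simp
    have w2 : ∀ f, f ∉ p.take (2 * j + 1) → weight (p.take (2 * j + 1) ++ [f]) =
        Function.update (weight (p.take (2 * j + 1))) f 0 := by
      intro f hf
      rw [weight_concat hf, if_neg]
      rw [List.length_take, min_eq_left hlt'.le]; simp
    obtain ⟨free, hmove⟩ := hσ (2 * j + 1) hlt' ⟨j, rfl⟩
    rw [e2, hmove]
    apply restoringStrategy_capped free
    rcases (ih hlt.le).respond hunc (weight_le_two _) (weight_eq_one_iff.2 (hnot _ hlt)) with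
      hc | ⟨f, hfe, hf1, hc⟩
    · obtain ⟨f, hf⟩ := free
      refine ⟨f, hf, ?_⟩
      rw [w2 f hf, w1]
      exact hc.update_zero f
    · have hf : f ∉ p.take (2 * j + 1) := by
        rw [e1, List.mem_append, List.mem_singleton]
        exact not_or.2 ⟨weight_eq_one_iff.1 hf1, hfe⟩
      refine ⟨f, hf, ?_⟩
      rw [w2 f hf, w1]
      exact hc

/-- If the sets `A i` can be uncrossed with respect to `b` and have at most `2 * b i` elements each,
then Breaker can prevent Maker from claiming more than `b i` elements of any `A i`. -/
theorem breakerHasWinningStrategy_of_uncrossing [Finite X]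
    (hunc : ∀ i j, (A i ∩ A j).Nonempty →
      ∃ p u, A p = A i ∩ A j ∧ A i ∪ A j ⊆ A u ∧ b p + b u ≤ b i + b j)
    (hcap : ∀ i, ((A i).card : ℤ) ≤ 2 * b i) (E : Set (Set X))
    (hE : ∀ Z ∈ E, ∃ i, Z ⊆ A i ∧ b i < Z.ncard) : BreakerHasWinningStrategy E := by
  have := Fintype.ofFinite X
  refine ⟨restoringStrategy A b, fun p hp hσ Z hZ hsub => ?_⟩
  have hfin : Capped A b (weight p) := by
    rcases Nat.even_or_odd' p.length with ⟨j, hj | hj⟩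
    · have := capped_take hunc hcap hp hσ j hj.ge
      rwa [← hj, List.take_length] at this
    · have hlt : 2 * j < p.length := by omega
      have h1 := capped_take hunc hcap hp hσ j hlt.le
      have e1 : p = p.take (2 * j) ++ [p[2 * j]] := by
        rw [List.take_append_getElem, ← hj, List.take_length]
      have hnot : p[2 * j] ∉ p.take (2 * j) := by
        have := hp.1
        rw [e1, List.nodup_append] at this
        exact fun h => this.2.2 _ h _ (by simp) rfl
      have w1 : weight p = Function.update (weight (p.take (2 * j))) p[2 * j] 2 := by
        conv_lhs => rw [e1]
        rw [weight_concat hnot, if_pos]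
        rw [List.length_take, min_eq_left hlt.le]; simp
      rcases h1.respond hunc (weight_le_two _) (weight_eq_one_iff.2 hnot) with
        hc | ⟨f, hfe, hf1, hc⟩
      · rwa [w1]
      -- Maker made the last move, so no free element is left for a reply.
      · have := hp.2 f
        rw [e1, List.mem_append, List.mem_singleton] at this
        exact absurd this (not_or.2 ⟨weight_eq_one_iff.1 hf1, hfe⟩)
  obtain ⟨i, hi, hlt⟩ := hE Z hZ
  classical
  have h1 : 2 * Z.ncard ≤ ∑ x ∈ A i, weight p x := by
    rw [Set.ncard_eq_toFinset_card' Z, mul_comm, ← smul_eq_mul]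
    calc Z.toFinset.card • 2 ≤ ∑ x ∈ Z.toFinset, weight p x :=
          Finset.card_nsmul_le_sum _ _ _ fun x hx =>
            ((weight_eq_two_iff hp.1).2 (hsub (by simpa using hx))).ge
      _ ≤ _ := Finset.sum_le_sum_of_subset fun x hx => hi (by simpa using hx)
  have := hfin i
  omega

end Potential

end MakerBreaker

/-! ### Capacities on spanned edge sets -/

namespace SimpleGraph

variable {V W : Type*}

theorem Subgraph.ncard_edgeSet_coe {G : SimpleGraph V} (J : G.Subgraph) :
    J.coe.edgeSet.ncard = J.edgeSet.ncard := by
  rw [← Subgraph.image_coe_edgeSet_coe,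
    Set.ncard_image_of_injective _ (Sym2.map.injective Subtype.coe_injective)]

theorem maxDensity_nonneg [Finite V] (G : SimpleGraph V) : 0 ≤ G.maxDensity := by
  refine Real.sSup_nonneg ?_
  rintro d ⟨J, -, rfl⟩
  unfold density
  positivity

theorem density_le_maxDensity [Finite V] (G : SimpleGraph V) (J : G.Subgraph)
    (hJ : J.verts.Nonempty) : J.coe.density ≤ G.maxDensity := by
  refine le_csSup (Set.Finite.bddAbove ?_) ⟨J, hJ, rfl⟩
  refine (Set.finite_range fun J : G.Subgraph => J.coe.density).subset ?_
  rintro d ⟨J, -, rfl⟩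
  exact ⟨J, rfl⟩

open Classical in
/-- The edges of `G` spanned by a set of vertices. -/
noncomputable def spannedEdges [Finite V] (G : SimpleGraph V) (S : Finset V) : Finset G.edgeSet :=
  (Set.toFinite {e : G.edgeSet | ∀ v ∈ e.1, v ∈ S}).toFinset

theorem mem_spannedEdges [Finite V] {G : SimpleGraph V} {S : Finset V} {e : G.edgeSet} :
    e ∈ G.spannedEdges S ↔ ∀ v ∈ e.1, v ∈ S := by
  simp [spannedEdges]

theorem card_spannedEdges [Finite V] (G : SimpleGraph V) (S : Finset V) :
    (G.spannedEdges S).card = ((⊤ : G.Subgraph).induce S).edgeSet.ncard := by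
  rw [← Set.ncard_coe_finset, ← Set.ncard_image_of_injective _ Subtype.val_injective]
  congr 1
  ext e
  induction e with
  | _ x y =>
    simp only [Set.mem_image, Finset.mem_coe, mem_spannedEdges, Subtype.exists, Subgraph.mem_edgeSet,
      Subgraph.induce_adj, Subgraph.top_adj, exists_and_left]
    constructor
    · rintro ⟨e, he, hG, rfl⟩
      exact ⟨he _ (by simp), he _ (by simp), hG⟩
    · rintro ⟨hx, hy, hG⟩
      exact ⟨s(x, y), by simpa using ⟨hx, hy⟩, hG, rfl⟩

theorem card_spannedEdges_le_mul [Finite V] (G : SimpleGraph V) {S : Finset V} (hS : S.Nonempty) :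
    ((G.spannedEdges S).card : ℝ) ≤ G.maxDensity * S.card := by
  have h := G.density_le_maxDensity ((⊤ : G.Subgraph).induce S) (by simpa using hS)
  have hpos : (0 : ℝ) < S.card := by exact_mod_cast hS.card_pos
  rw [density, Subgraph.ncard_edgeSet_coe, ← card_spannedEdges, div_le_iff₀] at h
  · simpa using h
  · simpa using hpos

theorem card_spannedEdges_le_choose [Finite V] (G : SimpleGraph V) (S : Finset V) :
    (G.spannedEdges S).card ≤ S.card.choose 2 := by
  classical
  have := Fintype.ofFinite V
  rw [card_spannedEdges, ← Subgraph.ncard_edgeSet_coe, Set.ncard_eq_toFinset_card']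
  refine card_edgeFinset_le_card_choose_two.trans ?_
  simp

theorem ncard_range_mapEdgeSet (H : SimpleGraph W) (G : SimpleGraph V) (f : Copy H G) :
    (Set.range f.mapEdgeSet).ncard = H.edgeSet.ncard := by
  rw [← Set.image_univ, Set.ncard_image_of_injective _ f.mapEdgeSet.injective, Set.ncard_univ]
  rfl

/-- Breaker wins against every `H` with `d₂(H) > 1`, balanced or not. -/
theorem breakerHasWinningStrategy_of_maxDensity_le_twoDensity [Finite V] [Finite W]
    (G : SimpleGraph V) (H : SimpleGraph W) (hW : 4 ≤ Nat.card W) (h1 : 1 < H.twoDensity)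
    (hG : G.maxDensity ≤ H.twoDensity) :
    MakerBreaker.BreakerHasWinningStrategy (copyEdgeSets H G) := by
  classical
  obtain ⟨n, hn⟩ : ∃ n : ℤ, n = (Nat.card W : ℤ) - 2 := ⟨_, rfl⟩
  obtain ⟨m, hm⟩ : ∃ m : ℤ, m = (H.edgeSet.ncard : ℤ) - 1 := ⟨_, rfl⟩
  have hn2 : 2 ≤ n := by omega
  have hn0 : (0 : ℝ) < n := by exact_mod_cast (by omega : 0 < n)
  have hq : H.twoDensity = m / n := by rw [twoDensity, hn, hm]; push_cast; rfl
  have hmn : n < m := by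
    rw [hq, one_lt_div hn0] at h1
    exact_mod_cast h1
  -- The slope is an integer in `[m/(2n), m/n)`: the lower bound serves large vertex sets, the upper
  -- one small sets.
  obtain ⟨k, hk1, hk2⟩ : ∃ k : ℤ, m ≤ 2 * (k * n) ∧ k * n < m := by
    by_cases h : m ≤ 2 * n
    · exact ⟨1, by omega, by omega⟩
    · refine ⟨(m - 1) / n, ?_, ?_⟩
      · have := Int.lt_ediv_add_one_mul_self (m - 1) (by omega : 0 < n)
        nlinarith
      · have := Int.ediv_mul_le (m - 1) (by omega : n ≠ 0)
        omega
  refine MakerBreaker.breakerHasWinningStrategy_of_uncrossing (ι := {S : Finset V // 2 ≤ S.card})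
    (A := fun S => G.spannedEdges S) (b := fun S => k * (S.1.card - Nat.card W) + m)
    ?_ ?_ _ ?_
  · rintro ⟨S, hS⟩ ⟨T, hT⟩ ⟨e, he⟩
    simp only [Finset.mem_inter, mem_spannedEdges] at he
    have hc : 2 ≤ (S ∩ T).card := by
      obtain ⟨⟨x, y⟩, hxy⟩ := e
      have hne : x ≠ y := G.ne_of_adj hxy
      rw [← Finset.card_pair hne]
      refine Finset.card_le_card ?_
      intro z hz
      rw [Finset.mem_insert, Finset.mem_singleton] at hz
      exact Finset.mem_inter.2 ⟨he.1 z (Sym2.mem_iff.2 hz), he.2 z (Sym2.mem_iff.2 hz)⟩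
    refine ⟨⟨S ∩ T, hc⟩, ⟨S ∪ T, hS.trans (Finset.card_le_card Finset.subset_union_left)⟩, ?_, ?_, ?_⟩
    · ext e
      simp only [Finset.mem_inter, mem_spannedEdges]
      exact ⟨fun h => ⟨fun v hv => (h v hv).1, fun v hv => (h v hv).2⟩,
        fun h v hv => ⟨h.1 v hv, h.2 v hv⟩⟩
    · intro e
      simp only [Finset.mem_union, mem_spannedEdges]
      rintro (h | h) v hv
      · exact Or.inl (h v hv)
      · exact Or.inr (h v hv)
    · have := Finset.card_union_add_card_inter S T
      zify at this
      simp only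
      linear_combination k * this
  · rintro ⟨S, hS⟩
    have hlin := G.card_spannedEdges_le_mul (S := S) (Finset.card_pos.1 (by omega))
    have hcho := G.card_spannedEdges_le_choose S
    simp only
    generalize (G.spannedEdges S).card = a at hlin hcho
    have hna : n * a ≤ m * S.card := by
      have : (a : ℝ) ≤ m / n * S.card :=
        hlin.trans (mul_le_mul_of_nonneg_right (hG.trans hq.le) (by positivity))
      rw [div_mul_eq_mul_div, le_div_iff₀ hn0] at this
      have : ((n * a : ℤ) : ℝ) ≤ (m * S.card : ℤ) := by push_cast; linarith
      exact_mod_cast this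
    have hWn : (Nat.card W : ℤ) = n + 2 := by omega
    rw [hWn]
    generalize S.card = s at *
    have hs : (2 : ℤ) ≤ s := by exact_mod_cast hS
    have hexp : n * (2 * (k * (s - (n + 2)) + m)) =
      2 * ((m - k * n) * (n + 2 - s)) + 2 * (m * (s - 2)) := by ring
    -- For `s ≤ 3` the density bound is too weak, so the trivial bound `s.choose 2` is used; from `s
    -- = 4` on, `s ≤ 2 * (s - 2)`.
    rcases Nat.lt_or_ge s 4 with hs4 | hs4
    · obtain rfl | rfl : s = 2 ∨ s = 3 := by omega
      · have : a ≤ 1 := hcho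
        push_cast
        nlinarith
      · have : a ≤ 3 := hcho
        push_cast
        nlinarith
    · have hs4' : (4 : ℤ) ≤ s := by exact_mod_cast hs4
      refine le_of_mul_le_mul_left (hna.trans ?_) (by omega : 0 < n)
      rcases le_total (s : ℤ) (n + 2) with hsn | hsn
      · rw [hexp]
        nlinarith [mul_nonneg (by omega : 0 ≤ m - k * n) (by omega : 0 ≤ n + 2 - (s : ℤ)),
          mul_nonneg (by omega : 0 ≤ m) (by omega : 0 ≤ (s : ℤ) - 4)]
      · nlinarith [mul_nonneg (by omega : 0 ≤ 2 * (k * n) - m) (by omega : 0 ≤ (s : ℤ) - (n + 2)),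
          mul_nonneg (by omega : 0 ≤ m) (by omega : 0 ≤ n - 2)]
  · rintro _ ⟨f, rfl⟩
    have := Fintype.ofFinite W
    have hcard : (Finset.univ.image f).card = Nat.card W := by
      rw [Finset.card_image_of_injective _ (show Function.Injective ⇑f from f.injective), Nat.card_eq_fintype_card, Finset.card_univ]
    refine ⟨⟨Finset.univ.image f, by omega⟩, ?_, ?_⟩
    · rintro _ ⟨⟨⟨x, y⟩, hxy⟩, rfl⟩
      rw [Finset.mem_coe, mem_spannedEdges]
      intro v hv
      obtain rfl | rfl : v = f x ∨ v = f y := Sym2.mem_iff.1 hv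
      · simp
      · simp
    · simp only
      rw [ncard_range_mapEdgeSet, hcard]
      simp [hm]

end SimpleGraph

/-! ### Strict 2-balancedness forces 2-density above 1 -/

namespace SimpleGraph

variable {W : Type*}

theorem edgeSet_induce_top (H : SimpleGraph W) (S : Set W) :
    ((⊤ : H.Subgraph).induce S).edgeSet = {e ∈ H.edgeSet | ∀ v ∈ e, v ∈ S} := by
  ext e
  induction e with
  | _ x y => simp; tauto

theorem IsStrictlyTwoBalanced.lt_of_induce [Finite W] {H : SimpleGraph W}
    (h : H.IsStrictlyTwoBalanced) (S : Finset W) (hS : 3 ≤ S.card) (hS' : S.card < Nat.card W) :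
    (({e ∈ H.edgeSet | ∀ v ∈ e, v ∈ S}.ncard : ℝ) - 1) / (S.card - 2) < H.twoDensity := by
  have h1 := h.2.2 ((⊤ : H.Subgraph).induce S) ?_ (by simpa using hS)
  · rw [h.2.1, twoDensity, Subgraph.ncard_edgeSet_coe, edgeSet_induce_top] at h1
    simpa using h1
  · intro htop
    have := congrArg (fun J : H.Subgraph => J.verts.ncard) htop
    simp [Set.ncard_univ] at this
    omega

/-- A graph on `a, b, c, d` whose only edges are `ab` and `cd` is a disjoint union of two edges. -/
theorem nonempty_iso_two_edges {H : SimpleGraph W} {a b c d : W}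
    (hab : ∀ x, H.Adj a x ↔ x = b) (hba : ∀ x, H.Adj b x ↔ x = a)
    (hcd : ∀ x, H.Adj c x ↔ x = d) (hdc : ∀ x, H.Adj d x ↔ x = c)
    (hac : a ≠ c) (had : a ≠ d) (hbc : b ≠ c) (hbd : b ≠ d)
    (hall : ∀ x, x = a ∨ x = b ∨ x = c ∨ x = d) :
    Nonempty (H ≃g ((⊤ : SimpleGraph (Fin 2)).sum (⊤ : SimpleGraph (Fin 2)))) := by
  have hne : a ≠ b := H.ne_of_adj ((hab b).2 rfl)
  have hne' : c ≠ d := H.ne_of_adj ((hcd d).2 rfl)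
  let φ : Fin 2 ⊕ Fin 2 → W := Sum.elim ![a, b] ![c, d]
  have hφ : Function.Bijective φ := by
    constructor
    · rintro (i | i) (j | j) <;> fin_cases i <;> fin_cases j <;>
        simp [φ, hne, hne', hac, had, hbc, hbd, hne.symm, hne'.symm, hac.symm, had.symm, hbc.symm,
          hbd.symm]
    · intro x
      rcases hall x with rfl | rfl | rfl | rfl
      exacts [⟨.inl 0, rfl⟩, ⟨.inl 1, rfl⟩, ⟨.inr 0, rfl⟩, ⟨.inr 1, rfl⟩]
  refine ⟨(⟨Equiv.ofBijective φ hφ, ?_⟩ : _ ≃g H).symm⟩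
  rintro (i | i) (j | j) <;> fin_cases i <;> fin_cases j <;>
    simp [φ, hac, had, hbc, hbd, hac.symm, had.symm, hbc.symm, hbd.symm, hab, hba, hcd, hdc]

/-- If `d₂(H) ≤ 1`, a path with two edges is already too dense and deleting an isolated vertex does
not lower `d₂`. So `H` is a perfect matching with `d₂(H) = 1/2`, the value attained by any two of
its edges; hence there are only two. The hypothesis `h0` rules out the edgeless graph. -/
theorem IsStrictlyTwoBalanced.one_lt_twoDensity [Finite W] {H : SimpleGraph W}
    (h : H.IsStrictlyTwoBalanced) (hW : 4 ≤ Nat.card W) (h0 : 0 ≤ H.twoDensity)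
    (hne : IsEmpty (H ≃g ((⊤ : SimpleGraph (Fin 2)).sum (⊤ : SimpleGraph (Fin 2))))) :
    1 < H.twoDensity := by
  classical
  have := Fintype.ofFinite W
  by_contra hle
  have hWr : (4 : ℝ) ≤ Nat.card W := by exact_mod_cast hW
  have hedge : (1 : ℝ) ≤ H.edgeSet.ncard := by
    rw [twoDensity, div_nonneg_iff] at h0
    rcases h0 with h0 | h0 <;> linarith
  have huniq : ∀ c a b, H.Adj c a → H.Adj c b → a = b := by
    intro c a b ha hb
    by_contra hab
    have hcard : ({c, a, b} : Finset W).card = 3 :=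
      Finset.card_eq_three.2 ⟨c, a, b, ha.ne, hb.ne, hab, rfl⟩
    have h1 := h.lt_of_induce {c, a, b} hcard.ge (by omega)
    have h2 : 2 ≤ {e ∈ H.edgeSet | ∀ v ∈ e, v ∈ ({c, a, b} : Finset W)}.ncard := by
      rw [← Set.ncard_pair (a := s(c, a)) (b := s(c, b)) (by simp [hab, ha.ne'])]
      refine Set.ncard_le_ncard ?_
      rintro e (rfl | rfl)
      · exact ⟨ha, by simp⟩
      · exact ⟨hb, by simp⟩
    have h2' : (2 : ℝ) ≤ {e ∈ H.edgeSet | ∀ v ∈ e, v ∈ ({c, a, b} : Finset W)}.ncard := by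
      exact_mod_cast h2
    rw [hcard, div_lt_iff₀ (by norm_num)] at h1
    push_cast at h1
    linarith
  have hex : ∀ a, ∃ b, H.Adj a b := by
    intro a
    by_contra! hno
    have hcard : (Finset.univ.erase a).card = Nat.card W - 1 := by
      rw [Finset.card_erase_of_mem (Finset.mem_univ a), Finset.card_univ, Nat.card_eq_fintype_card]
    have h1 := h.lt_of_induce (Finset.univ.erase a) (by omega) (by omega)
    have h2 : {e ∈ H.edgeSet | ∀ v ∈ e, v ∈ Finset.univ.erase a} = H.edgeSet := by
      ext e
      simp only [Set.mem_ofPred_eq, Finset.mem_erase, Finset.mem_univ, and_true, and_iff_left_iff_imp]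
      induction e with
      | _ x y =>
        rintro hxy v hv rfl
        obtain ⟨w, hw⟩ := Sym2.mem_iff_exists.1 hv
        rw [hw] at hxy
        exact hno w hxy
    rw [h2, hcard, twoDensity, Nat.cast_sub (by omega)] at h1
    refine absurd h1 (not_lt.2 ?_)
    push_cast
    exact div_le_div_of_nonneg_left (by linarith) (by linarith) (by linarith)
  choose p hp using hex
  have hiff : ∀ a x, H.Adj a x ↔ x = p a :=
    fun a x => ⟨fun hx => huniq a x (p a) hx (hp a), fun hx => hx ▸ hp a⟩
  have hpp : ∀ a, p (p a) = a := fun a => ((hiff _ _).1 (hp a).symm).symm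
  have hhalf : 2 * H.edgeSet.ncard = Nat.card W := by
    have h1 := H.sum_degrees_eq_twice_card_edges
    have h2 : ∀ v, H.degree v = 1 := by
      intro v
      rw [← card_neighborFinset_eq_degree, Finset.card_eq_one]
      exact ⟨p v, by ext x; simp [hiff]⟩
    rw [Finset.sum_congr rfl fun v _ => h2 v] at h1
    rw [← coe_edgeFinset, Set.ncard_coe_finset, Nat.card_eq_fintype_card]
    simpa using h1.symm
  have hq : H.twoDensity = 1 / 2 := by
    have : (2 : ℝ) * H.edgeSet.ncard = Nat.card W := by exact_mod_cast hhalf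
    rw [twoDensity, ← this, div_eq_div_iff (by linarith) (by norm_num)]
    ring
  obtain ⟨a⟩ : Nonempty W := (Nat.card_pos_iff.1 (by omega)).1
  obtain ⟨c, hc⟩ : ∃ c, c ∉ ({a, p a} : Finset W) := by
    by_contra! hall
    have := Finset.card_le_two (a := a) (b := p a)
    rw [Finset.eq_univ_of_forall hall, Finset.card_univ, ← Nat.card_eq_fintype_card] at this
    omega
  rw [Finset.mem_insert, Finset.mem_singleton, not_or] at hc
  have hac : a ≠ c := Ne.symm hc.1
  have hbc : p a ≠ c := Ne.symm hc.2
  have had : a ≠ p c := fun h => hbc (by rw [h, hpp])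
  have hbd : p a ≠ p c := fun h => hac (by rw [← hpp a, h, hpp])
  by_cases hall : ∀ x, x = a ∨ x = p a ∨ x = c ∨ x = p c
  · exact hne.elim (nonempty_iso_two_edges (hiff a) (fun x => by rw [hiff, hpp]) (hiff c)
      (fun x => by rw [hiff, hpp]) hac had hbc hbd hall).some
  · push Not at hall
    obtain ⟨x, hxa, hxb, hxc, hxd⟩ := hall
    have hcard : ({a, p a, c, p c} : Finset W).card = 4 :=
      Finset.card_eq_four.2 ⟨a, p a, c, p c, (hp a).ne, hac, had, hbc, hbd, (hp c).ne, rfl⟩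
    have hlt : ({a, p a, c, p c} : Finset W).card < Nat.card W := by
      rw [Nat.card_eq_fintype_card]
      exact Finset.card_lt_univ_of_notMem (x := x) (by simp [hxa, hxb, hxc, hxd])
    have h1 := h.lt_of_induce {a, p a, c, p c} (by omega) hlt
    have h2 : 2 ≤ {e ∈ H.edgeSet | ∀ v ∈ e, v ∈ ({a, p a, c, p c} : Finset W)}.ncard := by
      rw [← Set.ncard_pair (a := s(a, p a)) (b := s(c, p c)) (by simp [hac, had])]
      refine Set.ncard_le_ncard ?_
      rintro e (rfl | rfl)
      · exact ⟨hp a, by simp⟩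
      · exact ⟨hp c, by simp⟩
    have h2' : (2 : ℝ) ≤ {e ∈ H.edgeSet | ∀ v ∈ e, v ∈ ({a, p a, c, p c} : Finset W)}.ncard := by
      exact_mod_cast h2
    rw [hcard, hq, div_lt_iff₀ (by norm_num)] at h1
    push_cast at h1
    linarith

end SimpleGraph

theorem theorem4p3 {V W : Type*} [Finite V] [Finite W]
    (G : SimpleGraph V) (H : SimpleGraph W)
    (hdens : G.maxDensity ≤ H.maxTwoDensity)
    (hbal : H.IsStrictlyTwoBalanced)
    (hcard : 4 ≤ Nat.card W)
    (hne : IsEmpty (H ≃g ((⊤ : SimpleGraph (Fin 2)).sum (⊤ : SimpleGraph (Fin 2))))) :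
    MakerBreaker.BreakerHasWinningStrategy (SimpleGraph.copyEdgeSets H G) := by
  have hG : G.maxDensity ≤ H.twoDensity := hbal.2.1 ▸ hdens
  exact G.breakerHasWinningStrategy_of_maxDensity_le_twoDensity H hcard
    (hbal.one_lt_twoDensity hcard (G.maxDensity_nonneg.trans hG) hne) hG
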